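/- Let $Y$ and $U$ be uniformly convex, uniformly smooth real Banach spaces, let $p\in(1,\infty)$, and let $S\colon U\to Y$ be a map that is not affine-linear and that is weak-to-weak sequentially continuous, i.e., for every sequence $(u_n)$ in $U$ and every $u\in U$, $u_n\rightharpoonup u$ weakly in $U$ implies $S(u_n)\rightharpoonup S(u)$ weakly in $Y$. Then there exists a tuple $(y_d,u_d)\in Y\times U$ such that the problem $$\min_{(y,u)\in Y\times U}\ \|y-y_d\|_Y^p+\|u-u_d\|_U^p\quad\text{subject to } y=S(u)$$ possesses more than one global solution. -/

import Mathlib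

open Filter Topology

/-- A normed space is *uniformly smooth* if `(‖x + y‖ + ‖x - y‖) / 2 - 1` is `o(‖y‖)` as `y → 0`,
uniformly over the unit sphere in `x`. Equivalently, the modulus of smoothness
`ρ(t) = sup {(‖x + t • y‖ + ‖x - t • y‖) / 2 - 1 | ‖x‖ = 1, ‖y‖ = 1}` satisfies
`ρ(t) / t → 0` as `t → 0+`. -/
class UniformSmoothSpace (E : Type*) [SeminormedAddCommGroup E] : Prop where
  uniform_smooth : ∀ ⦃ε : ℝ⦄, 0 < ε → ∃ δ, 0 < δ ∧
    ∀ ⦃x : E⦄, ‖x‖ = 1 → ∀ ⦃y : E⦄, ‖y‖ ≤ δ → ‖x + y‖ + ‖x - y‖ ≤ 2 + ε * ‖y‖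

/-- Weak convergence of a sequence in a real normed space. -/
def WeaklyConverges {E : Type*} [NormedAddCommGroup E] [NormedSpace ℝ E]
    (x : ℕ → E) (a : E) : Prop :=
  Tendsto (fun n => toWeakSpace ℝ E (x n)) atTop (𝓝 (toWeakSpace ℝ E a))

/-- The objective `(y, u) ↦ ‖y - y_d‖ ^ p + ‖u - u_d‖ ^ p` of the tracking problem. -/
noncomputable def trackingCost {Y U : Type*} [NormedAddCommGroup Y] [NormedAddCommGroup U]
    (p : ℝ) (yd : Y) (ud : U) (z : Y × U) : ℝ :=
  ‖z.1 - yd‖ ^ p + ‖z.2 - ud‖ ^ p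

/-- The global solutions of the tracking problem
`min ‖y - y_d‖ ^ p + ‖u - u_d‖ ^ p` over `(y, u) ∈ Y × U` subject to `y = S u`. -/
def trackingSolutions {Y U : Type*} [NormedAddCommGroup Y] [NormedAddCommGroup U]
    (p : ℝ) (S : U → Y) (yd : Y) (ud : U) : Set (Y × U) :=
  {z | z.1 = S z.2 ∧ IsMinOn (trackingCost p yd ud) {w : Y × U | w.1 = S w.2} z}

/-!
Measured in the `ℓᵖ` norm of `Y × U`, a global solution for the data `(y_d, u_d)` is a nearest point
of the graph of `S` to `(y_d, u_d)`. If no data admitted two solutions, the graph would be a set with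
unique nearest points, and such a set is midpoint convex (Vlasov's theorem,
`ApproximativelyCompact.midpoint_mem`). A map with midpoint convex graph preserves midpoints, and
weak sequential continuity then makes it affine (`exists_affineMap_eq_of_map_midpoint`), contrary
to assumption.

Three facts carry the argument.

* The graph is approximatively compact (`approximativelyCompact_graph`): minimizing sequences have
  norm convergent subsequences. This combines weak sequential compactness of bounded sets
  (`exists_subseq_weaklyConverges`), weak sequential continuity of `S`, and the Kadec–Klee property
  of uniformly convex spaces. It yields nearest points and continuity of the nearest-point map.
* The `ℓᵖ` product is uniformly smooth (`WithLp.uniformSmoothSpace_prod`).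
* Continuity of the nearest-point map lets the distance to the graph grow with slope almost `1` from
  any point outside it (`ApproximativelyCompact.exists_infDist_add_mul_le`). Ekeland's principle
  continues this growth to any prescribed distance, so that large balls avoid the graph, and uniform
  smoothness makes the boundaries of such balls almost flat.
-/

/-! ### Weak convergence -/

theorem weaklyConverges_iff {E : Type*} [NormedAddCommGroup E] [NormedSpace ℝ E]
    {x : ℕ → E} {a : E} :
    WeaklyConverges x a ↔ ∀ f : StrongDual ℝ E, Tendsto (fun n => f (x n)) atTop (𝓝 (f a)) := by
  -- The weak topology is the one of the flipped pairing, which separates points by Hahn–Banach.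
  have hinj : Function.Injective ((topDualPairing ℝ E).flip) := by
    intro u v huv
    refine (SeparatingDual.eq_iff_forall_dual_eq (R := ℝ)).2 fun g => ?_
    exact DFunLike.congr_fun huv g
  exact WeakBilin.tendsto_iff_forall_eval_tendsto _ hinj

/-! ### Uniformly convex spaces -/

section UniformConvex

variable {E : Type*} [NormedAddCommGroup E] [NormedSpace ℝ E]

theorem exists_norm_le_of_norm_le_add {r δ : ℝ} (hr : 0 ≤ r) {x : E} (hx : ‖x‖ ≤ r + δ)
    (hδ : 0 ≤ δ) : ∃ w : E, ‖w‖ ≤ r ∧ ‖x - w‖ ≤ δ := by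
  rcases le_or_gt ‖x‖ r with h | h
  · exact ⟨x, h, by simpa using hδ⟩
  · have hx0 : 0 < ‖x‖ := hr.trans_lt h
    refine ⟨(r / ‖x‖) • x, ?_, ?_⟩
    · rw [norm_smul, Real.norm_of_nonneg (by positivity), div_mul_cancel₀ _ hx0.ne']
    · have : x - (r / ‖x‖) • x = (1 - r / ‖x‖) • x := by rw [sub_smul, one_smul]
      have h1 : r / ‖x‖ ≤ 1 := (div_le_one hx0).2 h.le
      rw [this, norm_smul, Real.norm_of_nonneg (by linarith), sub_mul, one_mul,
        div_mul_cancel₀ _ hx0.ne']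
      linarith

/-- Uniform convexity with slack: two vectors almost in the ball of radius `r` whose sum has norm
almost `2 * r` are close. The case `r = 0` is included. -/
theorem exists_norm_sub_lt_of_le_norm_add [UniformConvexSpace E] {r ε : ℝ} (hr : 0 ≤ r)
    (hε : 0 < ε) : ∃ δ, 0 < δ ∧ ∀ x y : E, ‖x‖ ≤ r + δ → ‖y‖ ≤ r + δ →
      2 * r - δ ≤ ‖x + y‖ → ‖x - y‖ < ε := by
  obtain ⟨δ₀, hδ₀, h⟩ :=
    exists_forall_closed_ball_dist_add_le_two_mul_sub E (half_pos hε) r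
  refine ⟨min (δ₀ / 4) (ε / 4), by positivity, fun x y hx hy hxy => ?_⟩
  set δ := min (δ₀ / 4) (ε / 4) with hδ
  have hδ1 : δ ≤ δ₀ / 4 := min_le_left _ _
  have hδ2 : δ ≤ ε / 4 := min_le_right _ _
  have hδp : 0 < δ := by positivity
  obtain ⟨w, hw, hxw⟩ := exists_norm_le_of_norm_le_add hr hx hδp.le
  obtain ⟨v, hv, hyv⟩ := exists_norm_le_of_norm_le_add hr hy hδp.le
  have h1 : ‖x + y‖ ≤ ‖w + v‖ + (‖x - w‖ + ‖y - v‖) := by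
    have : x + y = (w + v) + ((x - w) + (y - v)) := by abel
    rw [this]
    exact (norm_add_le _ _).trans (by gcongr; exact norm_add_le _ _)
  have h2 : ‖x - y‖ ≤ ‖w - v‖ + (‖x - w‖ + ‖y - v‖) := by
    have : x - y = (w - v) + ((x - w) - (y - v)) := by abel
    rw [this]
    exact (norm_add_le _ _).trans (by gcongr; exact norm_sub_le _ _)
  have h3 : ‖w - v‖ < ε / 2 := by
    by_contra! hc
    have := h hw hv hc
    linarith
  linarith

/-- The Kadec–Klee property of uniformly convex spaces. -/
theorem tendsto_of_weaklyConverges_of_tendsto_norm [UniformConvexSpace E] {x : ℕ → E} {a : E}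
    (hx : WeaklyConverges x a) (hn : Tendsto (fun n => ‖x n‖) atTop (𝓝 ‖a‖)) :
    Tendsto x atTop (𝓝 a) := by
  rw [Metric.tendsto_nhds]
  intro ε hε
  obtain ⟨δ, hδ, h⟩ := exists_norm_sub_lt_of_le_norm_add (E := E) (norm_nonneg a) hε
  obtain ⟨g, hg, hga⟩ := exists_dual_vector'' ℝ a
  have hga : g a = ‖a‖ := by simpa using hga
  have h1 := weaklyConverges_iff.1 hx g
  filter_upwards [h1.eventually_const_lt (u := ‖a‖ - δ) (by rw [hga]; linarith),
    hn.eventually_lt_const (u := ‖a‖ + δ) (by linarith)] with n hn1 hn2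
  rw [dist_eq_norm]
  refine h _ _ hn2.le (by linarith) ?_
  have h2 : g (x n + a) ≤ ‖x n + a‖ :=
    (le_abs_self _).trans ((g.le_opNorm _).trans (mul_le_of_le_one_left (norm_nonneg _) hg))
  rw [map_add, hga] at h2
  linarith

/-- A decreasing sequence of nonempty bounded convex sets in a uniformly convex Banach space has a
convergent selection: points of almost minimal norm form a Cauchy sequence. This is the form in
which reflexivity enters. -/
theorem exists_tendsto_of_antitone_convex [CompleteSpace E] [UniformConvexSpace E] {C : ℕ → Set E}
    (hanti : Antitone C) (hconv : ∀ n, Convex ℝ (C n)) (hne : ∀ n, (C n).Nonempty)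
    {B : ℝ} (hB : ∀ x ∈ C 0, ‖x‖ ≤ B) :
    ∃ (z : ℕ → E) (a : E), (∀ n, z n ∈ C n) ∧ Tendsto z atTop (𝓝 a) := by
  set r : ℕ → ℝ := fun n => Metric.infDist 0 (C n) with hr
  have hrle : ∀ n, ∀ x ∈ C n, r n ≤ ‖x‖ := fun n x hx => by
    simpa using Metric.infDist_le_dist_of_mem (x := (0 : E)) hx
  have hmono : Monotone r := fun m n hmn => Metric.infDist_le_infDist_of_subset (hanti hmn) (hne n)
  have hbdd : BddAbove (Set.range r) := by
    refine ⟨B, ?_⟩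
    rintro _ ⟨n, rfl⟩
    obtain ⟨x, hx⟩ := hne n
    exact (hrle n x hx).trans (hB x (hanti (Nat.zero_le n) hx))
  have hlim := tendsto_atTop_ciSup hmono hbdd
  set R := ⨆ n, r n
  have hrR : ∀ n, r n ≤ R := fun n => le_ciSup hbdd n
  have hR : 0 ≤ R := Metric.infDist_nonneg.trans (hrR 0)
  have hz : ∀ n : ℕ, ∃ z ∈ C n, ‖z‖ < r n + 1 / ((n : ℝ) + 1) := fun n => by
    obtain ⟨z, hz, h⟩ := (Metric.infDist_lt_iff (hne n)).1
      (show Metric.infDist 0 (C n) < r n + 1 / ((n : ℝ) + 1) from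
        lt_add_of_pos_right _ (by positivity))
    exact ⟨z, hz, by simpa using h⟩
  choose z hzC hzn using hz
  have hcauchy : CauchySeq z := by
    rw [Metric.cauchySeq_iff']
    intro ε hε
    obtain ⟨δ, hδ, h⟩ := exists_norm_sub_lt_of_le_norm_add (E := E) hR hε
    have e1 := hlim.eventually_const_lt (u := R - δ / 2) (by linarith)
    have e2 := (tendsto_one_div_add_atTop_nhds_zero_nat (𝕜 := ℝ)).eventually_lt_const hδ
    obtain ⟨N, hN⟩ := eventually_atTop.1 (e1.and e2)
    refine ⟨N, fun n hn => ?_⟩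
    rw [dist_eq_norm]
    have hbound : ∀ k ≥ N, ‖z k‖ ≤ R + δ := fun k hk => by
      have := (hN k hk).2
      have := hzn k
      have := hrR k
      linarith
    refine h _ _ (hbound n hn) (hbound N le_rfl) ?_
    have hmid := hrle N _ (hconv N (hanti hn (hzC n)) (hzC N) (a := 1 / 2) (b := 1 / 2)
      (by norm_num) (by norm_num) (by norm_num))
    rw [← smul_add, norm_smul, Real.norm_of_nonneg (by norm_num)] at hmid
    have := (hN N le_rfl).1
    linarith
  obtain ⟨a, ha⟩ := cauchySeq_tendsto_of_complete hcauchy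
  exact ⟨z, a, hzC, ha⟩

end UniformConvex

/-! ### Uniformly smooth spaces and weak sequential compactness -/

section UniformSmooth

variable {E : Type*} [NormedAddCommGroup E] [NormedSpace ℝ E]

/-- The smoothness estimate without normalization of `x`. Here `y` is small relative to `x`, so the
estimate applies to a fixed `y` once `‖x‖` is large. -/
theorem UniformSmoothSpace.exists_norm_add_add_norm_sub_le (E : Type*) [NormedAddCommGroup E]
    [NormedSpace ℝ E] [UniformSmoothSpace E] {ε : ℝ} (hε : 0 < ε) :
    ∃ δ, 0 < δ ∧ ∀ x y : E, ‖y‖ ≤ δ * ‖x‖ → ‖x + y‖ + ‖x - y‖ ≤ 2 * ‖x‖ + ε * ‖y‖ := by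
  obtain ⟨δ, hδ, h⟩ := UniformSmoothSpace.uniform_smooth (E := E) hε
  refine ⟨δ, hδ, fun x y hy => ?_⟩
  rcases eq_or_ne x 0 with rfl | hx
  · have : y = 0 := by simpa using hy
    simp [this]
  have hx0 : 0 < ‖x‖ := norm_pos_iff.2 hx
  have hs : ∀ v : E, ‖‖x‖⁻¹ • v‖ = ‖x‖⁻¹ * ‖v‖ := fun v => by
    rw [norm_smul, Real.norm_of_nonneg (by positivity)]
  have := h (x := ‖x‖⁻¹ • x) (by rw [hs, inv_mul_cancel₀ hx0.ne']) (y := ‖x‖⁻¹ • y)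
    (by rw [hs, inv_mul_le_iff₀ hx0, mul_comm]; exact hy)
  rw [← smul_add, ← smul_sub, hs, hs, hs, ← mul_add] at this
  rw [inv_mul_le_iff₀ hx0] at this
  calc _ ≤ _ := this
    _ = _ := by field_simp

instance UniformSmoothSpace.submodule [UniformSmoothSpace E] (W : Submodule ℝ E) :
    UniformSmoothSpace W where
  uniform_smooth ε hε := by
    obtain ⟨δ, hδ, h⟩ := UniformSmoothSpace.uniform_smooth (E := E) hε
    exact ⟨δ, hδ, fun x hx y hy => h (x := (x : E)) hx (y := (y : E)) hy⟩

/-- Functionals in the dual unit ball that almost attain the value `1` at the same unit vector are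
close in norm. This is uniform smoothness read on the dual side. -/
theorem UniformSmoothSpace.exists_norm_sub_le_of_le_apply (E : Type*) [NormedAddCommGroup E]
    [NormedSpace ℝ E] [UniformSmoothSpace E] {ε : ℝ} (hε : 0 < ε) :
    ∃ η, 0 < η ∧ ∀ (f g : StrongDual ℝ E) (w : E), ‖f‖ ≤ 1 → ‖g‖ ≤ 1 → ‖w‖ = 1 →
      1 - η ≤ f w → 1 - η ≤ g w → ‖f - g‖ ≤ ε := by
  obtain ⟨δ, hδ, h⟩ := UniformSmoothSpace.uniform_smooth (E := E) (half_pos hε)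
  refine ⟨ε * δ / 4, by positivity, fun f g w hf hg hw hfw hgw => ?_⟩
  have hle : ∀ (k : StrongDual ℝ E), ‖k‖ ≤ 1 → ∀ v, k v ≤ ‖v‖ := fun k hk v =>
    (le_abs_self _).trans ((k.le_opNorm _).trans (mul_le_of_le_one_left (norm_nonneg _) hk))
  have key : ∀ y : E, ‖y‖ = δ → (f - g) y ≤ ε * δ := fun y hy => by
    have h1 := h hw hy.le
    have h2 := hle f hf (w + y)
    have h3 := hle g hg (w - y)
    rw [map_add] at h2
    rw [map_sub] at h3
    rw [hy] at h1
    rw [sub_apply]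
    linarith
  refine ContinuousLinearMap.opNorm_le_bound _ hε.le fun y => ?_
  rcases eq_or_ne y 0 with rfl | hy
  · simp
  have hy0 : 0 < ‖y‖ := norm_pos_iff.2 hy
  have hn : ‖(δ / ‖y‖) • y‖ = δ := by
    rw [norm_smul, Real.norm_of_nonneg (by positivity), div_mul_cancel₀ _ hy0.ne']
  have k1 := key _ hn
  have k2 := key (-((δ / ‖y‖) • y)) (by rw [norm_neg, hn])
  rw [map_neg] at k2
  rw [map_smul, smul_eq_mul] at k1 k2
  have hscale : ∀ s : ℝ, δ / ‖y‖ * s ≤ ε * δ → s ≤ ε * ‖y‖ := fun s hs => by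
    rw [div_mul_eq_mul_div, div_le_iff₀ hy0] at hs
    exact le_of_mul_le_mul_left (by linarith) hδ
  rw [Real.norm_eq_abs, abs_le']
  exact ⟨hscale _ k1, hscale _ (by linarith)⟩

/-- The dual of a separable uniformly smooth space is separable: it is the closed span of norming
functionals at a countable dense set of points. -/
instance UniformSmoothSpace.separableSpace_strongDual [UniformSmoothSpace E]
    [TopologicalSpace.SeparableSpace E] : TopologicalSpace.SeparableSpace (StrongDual ℝ E) := by
  choose g hg hgu using fun n => exists_dual_vector'' ℝ (TopologicalSpace.denseSeq E n)
  have hgu : ∀ n, g n (TopologicalSpace.denseSeq E n) = ‖TopologicalSpace.denseSeq E n‖ :=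
    fun n => by simpa using hgu n
  set V : Submodule ℝ (StrongDual ℝ E) := Submodule.span ℝ (Set.range g) with hV
  have hsep : TopologicalSpace.IsSeparable (closure (V : Set (StrongDual ℝ E))) :=
    ((Set.countable_range g).isSeparable.span (R := ℝ)).closure
  have hunit : ∀ f : StrongDual ℝ E, ‖f‖ = 1 → f ∈ V.topologicalClosure := fun f hf => by
    rw [← SetLike.mem_coe, Submodule.topologicalClosure_coe, Metric.mem_closure_iff]
    intro ε hε
    obtain ⟨η, hη, h⟩ := UniformSmoothSpace.exists_norm_sub_le_of_le_apply E (half_pos hε)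
    obtain ⟨w, hw, hfw⟩ : ∃ w : E, ‖w‖ = 1 ∧ 1 - η ≤ f w := by
      by_contra! hc
      have : ‖f‖ ≤ max (1 - η) 0 := by
        refine ContinuousLinearMap.opNorm_le_of_unit_norm (le_max_right _ _) fun x hx => ?_
        refine le_trans ?_ (le_max_left _ _)
        rw [Real.norm_eq_abs, abs_le']
        refine ⟨(hc x hx).le, ?_⟩
        have := hc (-x) (by rw [norm_neg, hx])
        rw [map_neg] at this
        exact this.le
      rw [hf] at this
      rcases le_max_iff.1 this with h | h <;> linarith
    obtain ⟨n, hn⟩ := (TopologicalSpace.denseRange_denseSeq E).exists_dist_lt w (half_pos hη)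
    refine ⟨g n, Submodule.subset_span ⟨n, rfl⟩, ?_⟩
    rw [dist_eq_norm]
    refine (h f (g n) w hf.le (hg n) hw hfw ?_).trans_lt (by linarith)
    set u := TopologicalSpace.denseSeq E n
    rw [dist_eq_norm] at hn
    have h1 : g n (u - w) ≤ ‖u - w‖ := (le_abs_self _).trans
      (((g n).le_opNorm _).trans (mul_le_of_le_one_left (norm_nonneg _) (hg n)))
    rw [map_sub, hgu, norm_sub_rev] at h1
    have h2 : ‖w‖ - ‖u‖ ≤ ‖w - u‖ := norm_sub_norm_le _ _
    linarith
  have huniv : closure (V : Set (StrongDual ℝ E)) = Set.univ := by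
    rw [Set.eq_univ_iff_forall]
    intro f
    rw [← Submodule.topologicalClosure_coe, SetLike.mem_coe]
    rcases eq_or_ne f 0 with rfl | hf
    · exact zero_mem _
    have hf0 : ‖f‖ ≠ 0 := norm_ne_zero_iff.2 hf
    have h1 := hunit (‖f‖⁻¹ • f) (by rw [norm_smul, norm_inv, norm_norm, inv_mul_cancel₀ hf0])
    have h2 := V.topologicalClosure.smul_mem ‖f‖ h1
    rwa [smul_inv_smul₀ hf0] at h2
  rw [huniv] at hsep
  exact TopologicalSpace.isSeparable_univ_iff.1 hsep

/-- A bounded sequence has a weakly Cauchy subsequence, by compactness of a product of intervals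
indexed by a dense sequence in the dual of the span. -/
theorem exists_subseq_forall_dual_tendsto [UniformSmoothSpace E] {x : ℕ → E} {B : ℝ}
    (hB : ∀ n, ‖x n‖ ≤ B) :
    ∃ φ : ℕ → ℕ, StrictMono φ ∧
      ∀ f : StrongDual ℝ E, ∃ l : ℝ, Tendsto (fun n => f (x (φ n))) atTop (𝓝 l) := by
  set W : Submodule ℝ E := Submodule.span ℝ (Set.range x) with hW
  have : TopologicalSpace.SeparableSpace W :=
    ((Set.countable_range x).isSeparable.span (R := ℝ)).separableSpace
  set v : ℕ → W := fun n => ⟨x n, Submodule.subset_span ⟨n, rfl⟩⟩ with hv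
  have hvB : ∀ n, ‖v n‖ ≤ B := hB
  have hB0 : 0 ≤ B := (norm_nonneg _).trans (hB 0)
  set g := TopologicalSpace.denseSeq (StrongDual ℝ W) with hg
  obtain ⟨L, -, φ, hφ, hL⟩ := (isCompact_univ_pi fun k : ℕ =>
    isCompact_Icc (a := -(‖g k‖ * B)) (b := ‖g k‖ * B)).tendsto_subseq
    (x := fun n k => g k (v n)) (fun n k _ => by
      rw [Set.mem_Icc, ← abs_le, ← Real.norm_eq_abs]
      exact ((g k).le_opNorm _).trans (by gcongr; exact hvB n))
  rw [tendsto_pi_nhds] at hL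
  refine ⟨φ, hφ, fun f => ?_⟩
  set h : StrongDual ℝ W := f.comp W.subtypeL with hh
  have hfh : ∀ n, f (x n) = h (v n) := fun n => rfl
  refine cauchySeq_tendsto_of_complete ?_
  rw [Metric.cauchySeq_iff']
  intro ε hε
  obtain ⟨k, hk⟩ := (TopologicalSpace.denseRange_denseSeq (StrongDual ℝ W)).exists_dist_lt h
    (show 0 < ε / (3 * (B + 1)) by positivity)
  obtain ⟨N, hN⟩ := Metric.cauchySeq_iff'.1 (hL k).cauchySeq (ε / 3) (by positivity)
  replace hk : ‖h - g k‖ < ε / (3 * (B + 1)) :=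
    lt_of_eq_of_lt (dist_eq_norm h (g k)).symm hk
  refine ⟨N, fun n hn => ?_⟩
  have hnear : ∀ m, dist (h (v m)) (g k (v m)) < ε / 3 := fun m => by
    rw [dist_eq_norm, ← sub_apply]
    calc ‖(h - g k) (v m)‖ ≤ ‖h - g k‖ * ‖v m‖ := (h - g k).le_opNorm _
      _ ≤ ‖h - g k‖ * (B + 1) := by gcongr; linarith [hvB m]
      _ < ε / (3 * (B + 1)) * (B + 1) := by gcongr
      _ = ε / 3 := by field_simp
  have h1 := hnear (φ n)
  have h2 := hnear (φ N)
  have h3 := hN n hn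
  simp only [Function.comp_apply] at h3
  rw [dist_comm] at h2
  rw [hfh, hfh]
  calc dist (h (v (φ n))) (h (v (φ N)))
      ≤ dist (h (v (φ n))) (g k (v (φ n))) + dist (g k (v (φ n))) (g k (v (φ N)))
        + dist (g k (v (φ N))) (h (v (φ N))) := dist_triangle4 _ _ _ _
    _ < ε := by linarith

/-- Weak sequential compactness of bounded sets. The weak limit is the norm limit of convex
combinations of the tails of a weakly Cauchy subsequence. -/
theorem exists_subseq_weaklyConverges [CompleteSpace E] [UniformConvexSpace E]
    [UniformSmoothSpace E] {x : ℕ → E} {B : ℝ} (hB : ∀ n, ‖x n‖ ≤ B) :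
    ∃ (φ : ℕ → ℕ) (a : E), StrictMono φ ∧ WeaklyConverges (fun n => x (φ n)) a := by
  obtain ⟨φ, hφ, hl⟩ := exists_subseq_forall_dual_tendsto hB
  set C : ℕ → Set E := fun n => convexHull ℝ ((fun k => x (φ k)) '' Set.Ici n) with hC
  obtain ⟨z, a, hz, hza⟩ := exists_tendsto_of_antitone_convex (C := C) (B := B)
    (fun m n hmn => convexHull_mono (Set.image_mono (Set.Ici_subset_Ici.2 hmn)))
    (fun n => convex_convexHull ℝ _)
    (fun n => ⟨x (φ n), subset_convexHull ℝ _ ⟨n, Set.self_mem_Ici, rfl⟩⟩)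
    (fun y hy => by
      have : C 0 ⊆ Metric.closedBall 0 B := convexHull_min
        (by rintro _ ⟨k, -, rfl⟩; simpa using hB (φ k)) (convex_closedBall 0 B)
      simpa using this hy)
  refine ⟨φ, a, hφ, weaklyConverges_iff.2 fun f => ?_⟩
  obtain ⟨l, hl⟩ := hl f
  have hfz : Tendsto (fun n => f (z n)) atTop (𝓝 l) := by
    rw [Metric.tendsto_atTop'] at hl ⊢
    intro ε hε
    obtain ⟨N, hN⟩ := hl ε hε
    refine ⟨N, fun n hn => ?_⟩
    have : C n ⊆ f ⁻¹' Metric.ball l ε := convexHull_min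
      (by rintro _ ⟨k, hk, rfl⟩; exact hN k (lt_of_lt_of_le hn hk))
      ((convex_ball l ε).linear_preimage (f : E →ₗ[ℝ] ℝ))
    exact this (hz n)
  have : l = f a := tendsto_nhds_unique hfz ((f.continuous.tendsto a).comp hza)
  rwa [← this]

end UniformSmooth

/-! ### Uniform smoothness of `ℓᵖ` products -/

section PowerOfNorm

/-- The graph of `t ↦ t ^ p` lies above its tangent at `s`. -/
theorem Real.rpow_le_rpow_add_mul_sub {p : ℝ} (hp : 1 < p) {r s : ℝ} (hr : 0 ≤ r) (hs : 0 ≤ s) :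
    s ^ p + p * s ^ (p - 1) * (r - s) ≤ r ^ p := by
  rcases hs.eq_or_lt with rfl | hs
  · rw [Real.zero_rpow (by linarith), Real.zero_rpow (by linarith)]
    simpa using Real.rpow_nonneg hr p
  have h := one_add_mul_self_le_rpow_one_add (s := (r - s) / s) (p := p)
    (by rw [le_div_iff₀ hs]; linarith) hp.le
  have h1 : 1 + (r - s) / s = r / s := by field_simp; ring
  rw [h1, Real.div_rpow hr hs.le, le_div_iff₀ (Real.rpow_pos_of_pos hs p)] at h
  have h2 : s ^ p = s ^ (p - 1) * s := by
    rw [← Real.rpow_add_one hs.ne', sub_add_cancel]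
  calc s ^ p + p * s ^ (p - 1) * (r - s) = (1 + p * ((r - s) / s)) * s ^ p := by
        rw [h2]; field_simp
    _ ≤ r ^ p := h

/-- Uniform smoothness expressed by the `p`-th power of the norm. It holds uniformly on the whole
unit ball, including near `0`, and is therefore stable under `ℓᵖ` sums. -/
theorem UniformSmoothSpace.exists_rpow_norm_add_add_rpow_norm_sub_le (E : Type*)
    [NormedAddCommGroup E] [NormedSpace ℝ E] [UniformSmoothSpace E] {p : ℝ} (hp : 1 < p) {ε : ℝ}
    (hε : 0 < ε) :
    ∃ δ, 0 < δ ∧ ∀ x y : E, ‖x‖ ≤ 1 → ‖y‖ ≤ δ →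
      ‖x + y‖ ^ p + ‖x - y‖ ^ p ≤ 2 * ‖x‖ ^ p + ε * ‖y‖ := by
  have hp0 : 0 < p := by linarith
  have hp1 : 0 < p - 1 := by linarith
  have hε4 : 0 < ε / (4 * p) := by positivity
  obtain ⟨η, hη, hηε⟩ : ∃ η : ℝ, 0 < η ∧ ∀ t, 0 ≤ t → t ≤ η → t ^ (p - 1) ≤ ε / (4 * p) := by
    refine ⟨(ε / (4 * p)) ^ (p - 1)⁻¹, Real.rpow_pos_of_pos hε4 _, fun t ht ht' => ?_⟩
    calc t ^ (p - 1) ≤ ((ε / (4 * p)) ^ (p - 1)⁻¹) ^ (p - 1) := by gcongr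
      _ = ε / (4 * p) := Real.rpow_inv_rpow hε4.le hp1.ne'
  obtain ⟨δ₁, hδ₁, h1⟩ := UniformSmoothSpace.exists_norm_add_add_norm_sub_le E
    (show 0 < ε / (2 * p) by positivity)
  have hcont : ContinuousOn (fun t : ℝ => t ^ (p - 1)) (Set.Icc 0 2) :=
    (Real.continuous_rpow_const hp1.le).continuousOn
  obtain ⟨δ₂, hδ₂, h2⟩ := Metric.uniformContinuousOn_iff_le.1
    (isCompact_Icc.uniformContinuousOn_of_continuous hcont) (ε / (4 * p)) hε4
  refine ⟨min 1 (min (δ₁ * η) δ₂), by positivity, fun x y hx hy => ?_⟩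
  have hy1 : ‖y‖ ≤ 1 := hy.trans (min_le_left _ _)
  have hyη : ‖y‖ ≤ δ₁ * η := hy.trans ((min_le_right _ _).trans (min_le_left _ _))
  have hy2 : ‖y‖ ≤ δ₂ := hy.trans ((min_le_right _ _).trans (min_le_right _ _))
  set r := ‖x‖ with hr
  set c := ‖y‖ with hc
  have hr0 : 0 ≤ r := norm_nonneg _
  have hc0 : 0 ≤ c := norm_nonneg _
  have tangent : ∀ s : ℝ, 0 ≤ s → |s - r| ≤ c →
      s ^ p ≤ r ^ p + p * r ^ (p - 1) * (s - r) + ε / 4 * c := fun s hs hsr => by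
    have hs2 : s ≤ 2 := by linarith [(abs_le.1 hsr).2]
    have ht := Real.rpow_le_rpow_add_mul_sub hp hr0 hs
    have hu := h2 s ⟨hs, hs2⟩ r ⟨hr0, by linarith⟩ (by rw [Real.dist_eq]; linarith)
    rw [Real.dist_eq] at hu
    have : (s ^ (p - 1) - r ^ (p - 1)) * (s - r) ≤ ε / (4 * p) * c := by
      refine (le_abs_self _).trans ?_
      rw [abs_mul]
      gcongr
    have hmul := mul_le_mul_of_nonneg_left this hp0.le
    have : p * (ε / (4 * p) * c) = ε / 4 * c := by field_simp
    rw [this] at hmul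
    linarith
  have hs : |‖x + y‖ - r| ≤ c := by
    have := abs_norm_sub_norm_le (x + y) x
    rwa [add_sub_cancel_left] at this
  have ht : |‖x - y‖ - r| ≤ c := by
    have := abs_norm_sub_norm_le (x - y) x
    rwa [sub_sub_cancel_left, norm_neg] at this
  have ts := tangent _ (norm_nonneg _) hs
  have tt := tangent _ (norm_nonneg _) ht
  -- Smoothness gives nothing for small `r`, but there the slope `r ^ (p - 1)` is small.
  have main : p * r ^ (p - 1) * (‖x + y‖ + ‖x - y‖ - 2 * r) ≤ ε / 2 * c := by
    have hd : ‖x + y‖ + ‖x - y‖ - 2 * r ≤ 2 * c := by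
      linarith [(abs_le.1 hs).2, (abs_le.1 ht).2]
    rcases le_total r η with h | h
    · calc p * r ^ (p - 1) * (‖x + y‖ + ‖x - y‖ - 2 * r)
          ≤ p * r ^ (p - 1) * (2 * c) := by gcongr
        _ ≤ p * (ε / (4 * p)) * (2 * c) := by gcongr; exact hηε r hr0 h
        _ = ε / 2 * c := by field_simp; ring
    · have := h1 x y (hyη.trans (by gcongr))
      calc p * r ^ (p - 1) * (‖x + y‖ + ‖x - y‖ - 2 * r)
          ≤ p * r ^ (p - 1) * (ε / (2 * p) * c) := by gcongr; linarith
        _ ≤ p * 1 * (ε / (2 * p) * c) := by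
          gcongr; exact Real.rpow_le_one hr0 hx hp1.le
        _ = ε / 2 * c := by field_simp
  linarith

end PowerOfNorm

section LpProduct

variable {E F : Type*} [NormedAddCommGroup E] [NormedAddCommGroup F]

theorem WithLp.prod_norm_rpow {p : ℝ} (hp : 0 < p) (z : WithLp (ENNReal.ofReal p) (E × F)) :
    ‖z‖ ^ p = ‖z.fst‖ ^ p + ‖z.snd‖ ^ p := by
  have hpr : (ENNReal.ofReal p).toReal = p := ENNReal.toReal_ofReal hp.le
  rw [WithLp.prod_norm_eq_add (by rw [hpr]; exact hp), hpr, one_div,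
    Real.rpow_inv_rpow (by positivity) hp.ne']

/-- The estimates for `p`-th powers in the two factors pass to the norm of the `ℓᵖ` product, because
`t ^ p` lies above its tangent at `1`. -/
theorem WithLp.prod_norm_add_add_norm_sub_le {p : ℝ} (hp : 1 < p) [Fact (1 ≤ ENNReal.ofReal p)]
    [NormedSpace ℝ E] [NormedSpace ℝ F] {c : ℝ} {z h : WithLp (ENNReal.ofReal p) (E × F)}
    (hz : ‖z‖ = 1)
    (h1 : ‖z.fst + h.fst‖ ^ p + ‖z.fst - h.fst‖ ^ p ≤ 2 * ‖z.fst‖ ^ p + c / 2)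
    (h2 : ‖z.snd + h.snd‖ ^ p + ‖z.snd - h.snd‖ ^ p ≤ 2 * ‖z.snd‖ ^ p + c / 2) :
    ‖z + h‖ + ‖z - h‖ ≤ 2 + c := by
  have hp0 : 0 < p := by linarith
  have hz' := WithLp.prod_norm_rpow hp0 z
  rw [hz, Real.one_rpow] at hz'
  have hP := WithLp.prod_norm_rpow hp0 (z + h)
  have hQ := WithLp.prod_norm_rpow hp0 (z - h)
  rw [WithLp.add_fst, WithLp.add_snd] at hP
  rw [WithLp.sub_fst, WithLp.sub_snd] at hQ
  have tP := Real.rpow_le_rpow_add_mul_sub hp (norm_nonneg (z + h)) zero_le_one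
  have tQ := Real.rpow_le_rpow_add_mul_sub hp (norm_nonneg (z - h)) zero_le_one
  simp only [Real.one_rpow, mul_one] at tP tQ
  have hsum : 2 ≤ ‖z + h‖ + ‖z - h‖ := by
    have := norm_add_le (z + h) (z - h)
    rw [add_add_sub_cancel, ← two_smul ℝ z, norm_smul, hz] at this
    simpa using this
  have hmul : ‖z + h‖ + ‖z - h‖ - 2 ≤ p * (‖z + h‖ + ‖z - h‖ - 2) :=
    le_mul_of_one_le_left (by linarith) hp.le
  linarith

theorem WithLp.uniformSmoothSpace_prod [NormedSpace ℝ E] [NormedSpace ℝ F] [UniformSmoothSpace E]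
    [UniformSmoothSpace F] {p : ℝ} (hp : 1 < p) [Fact (1 ≤ ENNReal.ofReal p)] :
    UniformSmoothSpace (WithLp (ENNReal.ofReal p) (E × F)) := by
  refine ⟨fun ε hε => ?_⟩
  obtain ⟨δ₁, hδ₁, h1⟩ :=
    UniformSmoothSpace.exists_rpow_norm_add_add_rpow_norm_sub_le E hp (half_pos hε)
  obtain ⟨δ₂, hδ₂, h2⟩ :=
    UniformSmoothSpace.exists_rpow_norm_add_add_rpow_norm_sub_le F hp (half_pos hε)
  refine ⟨min δ₁ δ₂, lt_min hδ₁ hδ₂, fun z hz h hh => ?_⟩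
  have zf : ‖z.fst‖ ≤ ‖z‖ := WithLp.norm_fst_le E z
  have zs : ‖z.snd‖ ≤ ‖z‖ := WithLp.norm_snd_le E z
  have hf : ‖h.fst‖ ≤ ‖h‖ := WithLp.norm_fst_le E h
  have hs : ‖h.snd‖ ≤ ‖h‖ := WithLp.norm_snd_le E h
  have e1 := h1 z.fst h.fst (zf.trans hz.le) (hf.trans (hh.trans (min_le_left _ _)))
  have e2 := h2 z.snd h.snd (zs.trans hz.le) (hs.trans (hh.trans (min_le_right _ _)))
  have f1 := mul_le_mul_of_nonneg_left hf (half_pos hε).le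
  have f2 := mul_le_mul_of_nonneg_left hs (half_pos hε).le
  exact WithLp.prod_norm_add_add_norm_sub_le hp hz (by linarith) (by linarith)

end LpProduct

/-! ### Chebyshev sets in uniformly smooth spaces -/

/-- Ekeland's variational principle, for a function bounded above: starting from `x₀` one reaches,
with slope at least `s`, a point from which no further ascent with slope `s` is possible. -/
theorem exists_isMaximal_slope {X : Type*} [MetricSpace X] [CompleteSpace X] {f : X → ℝ}
    (hf : Continuous f) {B : ℝ} (hB : ∀ x, f x ≤ B) {s : ℝ} (hs : 0 < s) (x₀ : X) :
    ∃ y, f x₀ + s * dist x₀ y ≤ f y ∧ ∀ z, f y + s * dist y z ≤ f z → z = y := by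
  have hstep : ∀ (n : ℕ) (x : X), ∃ y, f x + s * dist x y ≤ f y ∧
      ∀ z, f x + s * dist x z ≤ f z → f z ≤ f y + (1 / 2) ^ n := fun n x => by
    set T : Set ℝ := f '' {z | f x + s * dist x z ≤ f z} with hT
    have hTne : T.Nonempty := ⟨f x, x, by simp, rfl⟩
    have hTb : BddAbove T := ⟨B, by rintro _ ⟨z, -, rfl⟩; exact hB z⟩
    obtain ⟨_, ⟨y, hy, rfl⟩, hlt⟩ := exists_lt_of_lt_csSup hTne
      (show sSup T - (1 / 2) ^ n < sSup T from sub_lt_self _ (by positivity))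
    exact ⟨y, hy, fun z hz => by linarith [le_csSup hTb (Set.mem_image_of_mem f hz)]⟩
  choose g hg1 hg2 using hstep
  set x : ℕ → X := fun n => Nat.rec x₀ (fun n y => g n y) n with hx
  have hx0 : x 0 = x₀ := rfl
  have hxs : ∀ n, x (n + 1) = g n (x n) := fun n => rfl
  have htrans : ∀ a b c : X, f a + s * dist a b ≤ f b → f b + s * dist b c ≤ f c →
      f a + s * dist a c ≤ f c := fun a b c hab hbc => by
    have := mul_le_mul_of_nonneg_left (dist_triangle a b c) hs.le
    linarith
  have hle : ∀ m n, m ≤ n → f (x m) + s * dist (x m) (x n) ≤ f (x n) := fun m n hmn => by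
    induction n, hmn using Nat.le_induction with
    | base => simp
    | succ n _ ih => exact htrans _ _ _ ih (by rw [hxs]; exact hg1 n (x n))
  have hclose : ∀ n z, f (x (n + 1)) + s * dist (x (n + 1)) z ≤ f z →
      dist (x (n + 1)) z ≤ (1 / 2) ^ n / s := fun n z hz => by
    have h1 := htrans _ _ _ (hle n (n + 1) n.le_succ) hz
    have h2 := hg2 n (x n) z h1
    rw [← hxs] at h2
    rw [le_div_iff₀ hs]
    linarith
  have hpow : Tendsto (fun n : ℕ => (1 / 2 : ℝ) ^ n / s) atTop (𝓝 0) := by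
    have := (tendsto_pow_atTop_nhds_zero_of_lt_one (r := (1 / 2 : ℝ)) (by norm_num)
      (by norm_num)).div_const s
    simpa using this
  have hcauchy : CauchySeq x := by
    rw [Metric.cauchySeq_iff']
    intro ε hε
    obtain ⟨N, hN⟩ := eventually_atTop.1 (hpow.eventually_lt_const hε)
    refine ⟨N + 1, fun n hn => ?_⟩
    rw [dist_comm]
    exact (hclose N _ (hle _ _ hn)).trans_lt (hN N le_rfl)
  obtain ⟨y, hy⟩ := cauchySeq_tendsto_of_complete hcauchy
  have hley : ∀ m, f (x m) + s * dist (x m) y ≤ f y := fun m => by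
    refine le_of_tendsto_of_tendsto (f := fun n => f (x m) + s * dist (x m) (x n))
      (g := fun n => f (x n)) (b := atTop)
      (((tendsto_const_nhds.dist hy).const_mul s).const_add _) ((hf.tendsto y).comp hy) ?_
    filter_upwards [eventually_ge_atTop m] with n hn using hle m n hn
  refine ⟨y, hley 0, fun z hz => ?_⟩
  have h1 : Tendsto (fun n => x (n + 1)) atTop (𝓝 z) := by
    rw [tendsto_iff_dist_tendsto_zero]
    exact squeeze_zero (fun _ => dist_nonneg)
      (fun n => hclose n z (htrans _ _ _ (hley (n + 1)) hz)) hpow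
  exact tendsto_nhds_unique h1 (hy.comp (tendsto_add_atTop_nat 1))

/-- A set `M` is approximatively compact if every sequence in `M` whose distances to some point `x`
converge to the distance from `x` to `M` has a subsequence converging to a point of `M`. -/
def ApproximativelyCompact {X : Type*} [PseudoMetricSpace X] (M : Set X) : Prop :=
  ∀ (x : X) (m : ℕ → X), (∀ n, m n ∈ M) →
    Tendsto (fun n => dist x (m n)) atTop (𝓝 (Metric.infDist x M)) →
      ∃ a ∈ M, ∃ φ : ℕ → ℕ, StrictMono φ ∧ Tendsto (fun n => m (φ n)) atTop (𝓝 a)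

section Chebyshev

theorem ApproximativelyCompact.exists_infDist_eq_dist {X : Type*} [PseudoMetricSpace X] {M : Set X}
    (hM : ApproximativelyCompact M) (hne : M.Nonempty) (x : X) :
    ∃ m ∈ M, dist x m = Metric.infDist x M := by
  have h : ∀ n : ℕ, ∃ m ∈ M, dist x m < Metric.infDist x M + 1 / ((n : ℝ) + 1) := fun n =>
    (Metric.infDist_lt_iff hne).1 (lt_add_of_pos_right _ (by positivity))
  choose m hm hlt using h
  have hlim : Tendsto (fun n => dist x (m n)) atTop (𝓝 (Metric.infDist x M)) := by
    refine tendsto_of_tendsto_of_tendsto_of_le_of_le tendsto_const_nhds ?_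
      (fun n => Metric.infDist_le_dist_of_mem (hm n)) (fun n => (hlt n).le)
    simpa using (tendsto_one_div_add_atTop_nhds_zero_nat (𝕜 := ℝ)).const_add (Metric.infDist x M)
  obtain ⟨a, ha, φ, hφ, hφa⟩ := hM x m hm hlim
  exact ⟨a, ha, tendsto_nhds_unique (tendsto_const_nhds.dist hφa) (hlim.comp hφ.tendsto_atTop)⟩

variable {E : Type*} [NormedAddCommGroup E] [NormedSpace ℝ E] {M : Set E}

/-- When nearest points are unique, the distance to `M` grows with slope arbitrarily close to `1` in
some direction at every point outside `M`: with nearest point `m`, move from `x` along `x - m`. The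
nearest points of the displaced points converge to `m`. -/
theorem ApproximativelyCompact.exists_infDist_add_mul_le (hM : ApproximativelyCompact M)
    (hne : M.Nonempty)
    (huniq : ∀ x, ∀ a ∈ M, ∀ b ∈ M, dist x a = Metric.infDist x M → dist x b = Metric.infDist x M →
      a = b)
    {x : E} (hx : 0 < Metric.infDist x M) {s ρ : ℝ} (hs : s < 1) (hρ : 0 < ρ) :
    ∃ y, y ≠ x ∧ dist x y ≤ ρ ∧ Metric.infDist x M + s * dist x y ≤ Metric.infDist y M := by
  set d := Metric.infDist x M with hd
  obtain ⟨m, hm, hxm⟩ := hM.exists_infDist_eq_dist hne x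
  rw [← hd, dist_eq_norm] at hxm
  set t : ℕ → ℝ := fun n => 1 / ((n : ℝ) + 1) with ht
  have ht0 : ∀ n, 0 < t n := fun n => by positivity
  have htlim : Tendsto t atTop (𝓝 0) := tendsto_one_div_add_atTop_nhds_zero_nat
  set y : ℕ → E := fun n => x + t n • (x - m) with hy
  have hxy : ∀ n, dist x (y n) = t n * d := fun n => by
    rw [dist_eq_norm, hy, sub_add_cancel_left, norm_neg, norm_smul, hxm,
      Real.norm_of_nonneg (ht0 n).le]
  have hxylim : Tendsto (fun n => dist x (y n)) atTop (𝓝 0) := by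
    simp_rw [hxy]
    simpa using htlim.mul_const d
  choose q hqM hq using fun n => hM.exists_infDist_eq_dist hne (y n)
  have hqlim : Tendsto (fun n => dist x (q n)) atTop (𝓝 d) := by
    refine tendsto_of_tendsto_of_tendsto_of_le_of_le (h := fun n => d + 2 * dist x (y n))
      tendsto_const_nhds (by simpa using (hxylim.const_mul 2).const_add d)
      (fun n => Metric.infDist_le_dist_of_mem (hqM n)) (fun n => ?_)
    have h1 := dist_triangle x (y n) (q n)
    have h2 := Metric.infDist_le_infDist_add_dist (s := M) (x := y n) (y := x)
    rw [hq] at h1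
    rw [dist_comm] at h2
    simp only
    linarith
  obtain ⟨a, ha, φ, hφ, hφa⟩ := hM x q hqM hqlim
  have ham : a = m := huniq x a ha m hm
    (tendsto_nhds_unique (tendsto_const_nhds.dist hφa) (hqlim.comp hφ.tendsto_atTop))
    (by rw [dist_eq_norm, hxm])
  rw [ham] at hφa
  have e1 := (tendsto_iff_dist_tendsto_zero.1 hφa).eventually_lt_const
    (show 0 < (1 - s) * d from mul_pos (by linarith) hx)
  have e2 := (hxylim.comp hφ.tendsto_atTop).eventually_lt_const hρ
  obtain ⟨k, hk1, hk2⟩ := (e1.and e2).exists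
  set n := φ k
  refine ⟨y n, ?_, hk2.le, ?_⟩
  · intro h
    have := hxy n
    rw [h, dist_self] at this
    exact (mul_pos (ht0 n) hx).ne this
  · rw [hxy, ← hq, dist_eq_norm]
    rw [dist_eq_norm] at hk1
    have hdq : d ≤ ‖x - q n‖ := by
      rw [← dist_eq_norm]; exact Metric.infDist_le_dist_of_mem (hqM n)
    -- `y n - q n` is almost `(1 + t n) • (x - q n)`, because `q n` is close to `m`.
    have hdec : (1 + t n) • (x - q n) = (y n - q n) - t n • (q n - m) := by
      simp only [hy]; module
    have h1 : (1 + t n) * ‖x - q n‖ ≤ ‖y n - q n‖ + t n * ‖q n - m‖ := by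
      have := norm_sub_le (y n - q n) (t n • (q n - m))
      rwa [← hdec, norm_smul, norm_smul, Real.norm_of_nonneg (ht0 n).le,
        Real.norm_of_nonneg (by linarith [ht0 n])] at this
    have h2 : (1 + t n) * d ≤ (1 + t n) * ‖x - q n‖ := by
      have := ht0 n
      gcongr
    have h3 := mul_le_mul_of_nonneg_left hk1.le (ht0 n).le
    linarith

/-- An approximatively compact set with unique nearest points in a uniformly smooth Banach space is
midpoint convex. If the midpoint `x` of `a, b ∈ M` were outside `M`, there would be arbitrarily
large balls disjoint from `M` that contain `x` at a depth bounded below. At a large scale the sphere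
of such a ball is almost flat, which leaves no room for both `a` and `b` outside. -/
theorem ApproximativelyCompact.midpoint_mem [CompleteSpace E] [UniformSmoothSpace E]
    (hM : ApproximativelyCompact M)
    (huniq : ∀ x, ∀ a ∈ M, ∀ b ∈ M, dist x a = Metric.infDist x M → dist x b = Metric.infDist x M →
      a = b)
    {a b : E} (ha : a ∈ M) (hb : b ∈ M) : midpoint ℝ a b ∈ M := by
  have hne : M.Nonempty := ⟨a, ha⟩
  by_contra hx
  set x := midpoint ℝ a b with hxdef
  have hpos : 0 < Metric.infDist x M := by
    obtain ⟨m, hm, hxm⟩ := hM.exists_infDist_eq_dist hne x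
    rw [← hxm, dist_pos]
    rintro rfl
    exact hx hm
  set d := Metric.infDist x M with hd
  set h := a - x with hh
  have hbx : b - x = -h := by
    rw [hh, hxdef, left_sub_midpoint, right_sub_midpoint, ← smul_neg, neg_sub]
  obtain ⟨δ, hδ, hsm⟩ := UniformSmoothSpace.exists_norm_add_add_norm_sub_le E
    (show 0 < d / (2 * (‖h‖ + 1)) by positivity)
  -- `R` is so large that the smoothness estimate holds for `h` at points of norm `R`, and `s` is
  -- so close to `1` that the slope `s` loses only `d / 2` over the distance `R`.
  set R := ‖h‖ / δ + d with hR
  have hRd : d ≤ R := le_add_of_nonneg_left (by positivity)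
  have hR0 : 0 < R := hpos.trans_le hRd
  have hRh : ‖h‖ ≤ δ * R := by
    rw [hR, mul_add, mul_div_cancel₀ _ hδ.ne']
    exact le_add_of_nonneg_right (by positivity)
  set s := 1 - d / (2 * R) with hs
  have hsR : s * R = R - d / 2 := by rw [hs]; field_simp
  have hs0 : 0 < s := by
    refine pos_of_mul_pos_left (b := R) ?_ hR0.le
    rw [hsR]; linarith
  have hs1 : s < 1 := sub_lt_self _ (by positivity)
  have : CompleteSpace (Metric.closedBall x R) := Metric.isClosed_closedBall.completeSpace_coe
  -- Maximality on the ball of radius `R` drives the point to the boundary sphere.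
  obtain ⟨⟨c, hcR⟩, hc1, hc2⟩ := exists_isMaximal_slope (X := Metric.closedBall x R)
    (f := fun y => Metric.infDist (y : E) M)
    ((Metric.continuous_infDist_pt M).comp continuous_subtype_val) (B := d + R)
    (fun y => (Metric.infDist_le_infDist_add_dist (y := x)).trans
      (by rw [← hd]; gcongr; exact Metric.mem_closedBall.1 y.2)) hs0
    ⟨x, Metric.mem_closedBall_self hR0.le⟩
  simp only [Subtype.dist_eq, Subtype.forall, Subtype.mk.injEq] at hc1 hc2
  rw [← hd] at hc1
  have hcx : dist c x = R := by
    by_contra hne'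
    have hlt : dist c x < R := lt_of_le_of_ne (Metric.mem_closedBall.1 hcR) hne'
    obtain ⟨y, hyc, hyd, hy⟩ := hM.exists_infDist_add_mul_le hne huniq (x := c)
      (by have := mul_nonneg hs0.le (dist_nonneg (x := x) (y := c)); linarith) hs1
      (sub_pos.2 hlt)
    refine hyc (hc2 y ?_ hy)
    rw [Metric.mem_closedBall]
    have := dist_triangle_left y x c
    linarith
  rw [dist_comm x c, hcx, hsR] at hc1
  have hca : Metric.infDist c M ≤ ‖(x - c) + h‖ := by
    have := Metric.infDist_le_dist_of_mem (x := c) ha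
    rwa [dist_comm, dist_eq_norm, show a - c = (x - c) + h by rw [hh]; abel] at this
  have hcb : Metric.infDist c M ≤ ‖(x - c) - h‖ := by
    have := Metric.infDist_le_dist_of_mem (x := c) hb
    rwa [dist_comm, dist_eq_norm, show b - c = (x - c) - h by
      rw [sub_eq_add_neg (x - c), ← hbx]; abel] at this
  rw [dist_comm, dist_eq_norm] at hcx
  have hfin := hsm (x - c) h (by rwa [hcx])
  rw [hcx] at hfin
  have hlast : d / (2 * (‖h‖ + 1)) * ‖h‖ < d := by
    rw [div_mul_eq_mul_div, div_lt_iff₀ (by positivity)]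
    nlinarith [norm_nonneg h]
  linarith

end Chebyshev

/-! ### Graphs of weakly sequentially continuous maps -/

section WeakGraph

theorem WeaklyConverges.const_sub {E : Type*} [NormedAddCommGroup E] [NormedSpace ℝ E]
    {x : ℕ → E} {a : E} (h : WeaklyConverges x a) (b : E) :
    WeaklyConverges (fun n => b - x n) (b - a) := by
  rw [weaklyConverges_iff] at h ⊢
  intro f
  simp only [map_sub]
  exact (h f).const_sub (f b)

/-- Weak lower semicontinuity of `‖·‖ ^ p`, as a convergent sequence of lower bounds. -/
theorem WeaklyConverges.exists_le_rpow_norm {E : Type*} [NormedAddCommGroup E] [NormedSpace ℝ E]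
    {x : ℕ → E} {a : E} (h : WeaklyConverges x a) {p : ℝ} (hp : 0 < p) :
    ∃ l : ℕ → ℝ, (∀ n, l n ≤ ‖x n‖ ^ p) ∧ Tendsto l atTop (𝓝 (‖a‖ ^ p)) := by
  obtain ⟨g, hg, hga⟩ := exists_dual_vector'' ℝ a
  have hga : g a = ‖a‖ := by simpa using hga
  refine ⟨fun n => max (g (x n)) 0 ^ p, fun n => ?_, ?_⟩
  · refine Real.rpow_le_rpow (le_max_right _ _) (max_le ?_ (norm_nonneg _)) hp.le
    exact (le_abs_self _).trans
      ((g.le_opNorm _).trans (mul_le_of_le_one_left (norm_nonneg _) hg))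
  · have h1 := (weaklyConverges_iff.1 h g).max (tendsto_const_nhds (x := (0 : ℝ)))
    rw [hga, max_eq_left (norm_nonneg a)] at h1
    exact h1.rpow_const (Or.inr hp.le)

theorem tendsto_fst_of_tendsto_add {α β l l' : ℕ → ℝ} {A B D : ℝ} (hl : Tendsto l atTop (𝓝 A))
    (hl' : Tendsto l' atTop (𝓝 B)) (hlα : ∀ n, l n ≤ α n) (hlβ : ∀ n, l' n ≤ β n)
    (hD : Tendsto (fun n => α n + β n) atTop (𝓝 D)) (hDle : D ≤ A + B) :
    Tendsto α atTop (𝓝 A) := by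
  have hge : A + B ≤ D := le_of_tendsto_of_tendsto' (hl.add hl') hD
    fun n => add_le_add (hlα n) (hlβ n)
  have hDB := hD.sub hl'
  rw [show D - B = A by linarith] at hDB
  exact tendsto_of_tendsto_of_tendsto_of_le_of_le hl hDB hlα
    fun n => by have := hlβ n; simp only; linarith

theorem WeaklyConverges.tendsto_of_tendsto_rpow_norm_sub {E : Type*} [NormedAddCommGroup E]
    [NormedSpace ℝ E] [UniformConvexSpace E] {x : ℕ → E} {a b : E} (h : WeaklyConverges x a)
    {p : ℝ} (hp : 0 < p) (hn : Tendsto (fun n => ‖b - x n‖ ^ p) atTop (𝓝 (‖b - a‖ ^ p))) :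
    Tendsto x atTop (𝓝 a) := by
  have h1 := hn.rpow_const (p := p⁻¹) (Or.inr (by positivity))
  simp only [Real.rpow_rpow_inv (norm_nonneg _) hp.ne'] at h1
  have h2 := (tendsto_of_weaklyConverges_of_tendsto_norm (h.const_sub b) h1).const_sub b
  simpa using h2

variable {Y U : Type*}
  [NormedAddCommGroup Y] [NormedSpace ℝ Y] [UniformConvexSpace Y]
  [NormedAddCommGroup U] [NormedSpace ℝ U] [CompleteSpace U]
  [UniformConvexSpace U] [UniformSmoothSpace U]

/-- In the `ℓᵖ` product the graph of a weakly sequentially continuous map is approximatively compact.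
A minimizing sequence has weakly convergent second components, hence weakly convergent first
components. Both norms then converge, and the Kadec–Klee property applies in each factor. -/
theorem approximativelyCompact_graph {p : ℝ} (hp : 1 < p) [Fact (1 ≤ ENNReal.ofReal p)] {S : U → Y}
    (hSw : ∀ (u : ℕ → U) (a : U),
      WeaklyConverges u a → WeaklyConverges (fun n => S (u n)) (S a)) :
    ApproximativelyCompact {z : WithLp (ENNReal.ofReal p) (Y × U) | z.fst = S z.snd} := by
  have hp0 : 0 < p := by linarith
  intro x m hm hlim
  set M := {z : WithLp (ENNReal.ofReal p) (Y × U) | z.fst = S z.snd} with hMdef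
  obtain ⟨B, hB⟩ := hlim.bddAbove_range
  have hbound : ∀ n, ‖(m n).snd‖ ≤ ‖x‖ + B := fun n => by
    have h1 : dist x (m n) ≤ B := hB ⟨n, rfl⟩
    rw [dist_eq_norm] at h1
    have h2 := norm_sub_norm_le (m n) x
    rw [norm_sub_rev] at h2
    linarith [WithLp.norm_snd_le Y (m n)]
  obtain ⟨φ, u, hφ, hu⟩ := exists_subseq_weaklyConverges hbound
  have hy := hSw _ _ hu
  set a : WithLp (ENNReal.ofReal p) (Y × U) := WithLp.toLp _ (S u, u) with ha
  have haM : a ∈ M := rfl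
  have hmS : ∀ n, (m n).fst = S (m n).snd := hm
  simp only [← hmS] at hy
  refine ⟨a, haM, φ, hφ, ?_⟩
  obtain ⟨l, hl, hlt⟩ := (hy.const_sub x.fst).exists_le_rpow_norm hp0
  obtain ⟨l', hl', hlt'⟩ := (hu.const_sub x.snd).exists_le_rpow_norm hp0
  have hD : Tendsto (fun n => ‖x.fst - (m (φ n)).fst‖ ^ p + ‖x.snd - (m (φ n)).snd‖ ^ p) atTop
      (𝓝 (Metric.infDist x M ^ p)) := by
    have := (hlim.comp hφ.tendsto_atTop).rpow_const (p := p) (Or.inr hp0.le)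
    refine this.congr fun n => ?_
    rw [Function.comp_apply, dist_eq_norm, WithLp.prod_norm_rpow hp0, WithLp.sub_fst,
      WithLp.sub_snd]
  have hDle : Metric.infDist x M ^ p ≤ ‖x.fst - S u‖ ^ p + ‖x.snd - u‖ ^ p := by
    have h1 := Metric.infDist_le_dist_of_mem (x := x) haM
    have h2 : Metric.infDist x M ^ p ≤ dist x a ^ p :=
      Real.rpow_le_rpow Metric.infDist_nonneg h1 hp0.le
    rwa [dist_eq_norm, WithLp.prod_norm_rpow hp0] at h2
  have hfst := hy.tendsto_of_tendsto_rpow_norm_sub hp0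
    (tendsto_fst_of_tendsto_add hlt hlt' hl hl' hD hDle)
  have hsnd := hu.tendsto_of_tendsto_rpow_norm_sub hp0
    (tendsto_fst_of_tendsto_add hlt' hlt hl' hl (by simpa only [add_comm] using hD)
      (by rwa [add_comm]))
  exact ((WithLp.prod_continuous_toLp _ Y U).tendsto (S u, u)).comp (hfst.prodMk_nhds hsnd)

end WeakGraph

/-- Weak sequential continuity takes the place of continuity in the passage from midpoint-preserving
to affine. -/
theorem exists_affineMap_eq_of_map_midpoint {Y U : Type*} [NormedAddCommGroup Y] [NormedSpace ℝ Y]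
    [NormedAddCommGroup U] [NormedSpace ℝ U] {S : U → Y}
    (hS : ∀ u v, S (midpoint ℝ u v) = midpoint ℝ (S u) (S v))
    (hSw : ∀ (u : ℕ → U) (a : U),
      WeaklyConverges u a → WeaklyConverges (fun n => S (u n)) (S a)) :
    ∃ A : U →ᵃ[ℝ] Y, ∀ u, S u = A u := by
  set T : U →+ Y := AddMonoidHom.ofMapMidpoint ℝ ℝ (fun u => S u - S 0) (sub_self _)
    (fun u v => by
      rw [hS, midpoint_eq_smul_add, midpoint_eq_smul_add, invOf_eq_inv]
      module) with hT
  have hTapp : ∀ u, T u = S u - S 0 := fun u => rfl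
  have hsmul : ∀ (c : ℝ) (u : U), T (c • u) = c • T u := fun c u => by
    refine (SeparatingDual.eq_iff_forall_dual_eq (R := ℝ)).2 fun g => ?_
    set G : ℝ →+ ℝ := (g : Y →+ ℝ).comp (T.comp ((smulAddHom ℝ U).flip u)) with hG
    have hGapp : ∀ t, G t = g (T (t • u)) := fun t => rfl
    have hGc : Continuous G := by
      rw [continuous_iff_seqContinuous]
      intro t t₀ ht
      have h1 : WeaklyConverges (fun n => t n • u) (t₀ • u) := weaklyConverges_iff.2 fun f => by
        simp only [map_smul]
        exact ht.smul_const (f u)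
      have h2 := (weaklyConverges_iff.1 (hSw _ _ h1) g).sub_const (g (S 0))
      simpa only [Function.comp_def, hGapp, hTapp, map_sub] using h2
    have := map_real_smul G hGc c 1
    rw [hGapp, hGapp, smul_eq_mul, mul_one, one_smul] at this
    rw [this, map_smul]
  let L : U →ₗ[ℝ] Y := { T with map_smul' := hsmul }
  refine ⟨L.toAffineMap + AffineMap.const ℝ U (S 0), fun u => ?_⟩
  exact (sub_add_cancel (S u) (S 0)).symm

/-! ### Nonuniqueness for the tracking problem -/

theorem theorem2p3 {Y U : Type*}
    [NormedAddCommGroup Y] [NormedSpace ℝ Y] [CompleteSpace Y]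
    [UniformConvexSpace Y] [UniformSmoothSpace Y]
    [NormedAddCommGroup U] [NormedSpace ℝ U] [CompleteSpace U]
    [UniformConvexSpace U] [UniformSmoothSpace U]
    (p : ℝ) (hp : 1 < p) (S : U → Y)
    (hS : ¬ ∃ A : U →ᵃ[ℝ] Y, ∀ u, S u = A u)
    (hSw : ∀ (u : ℕ → U) (a : U),
      WeaklyConverges u a → WeaklyConverges (fun n => S (u n)) (S a)) :
    ∃ (yd : Y) (ud : U), (trackingSolutions p S yd ud).Nontrivial := by
  by_contra! hsub
  have hp0 : 0 < p := by linarith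
  have : Fact (1 ≤ ENNReal.ofReal p) := ⟨by simpa using hp.le⟩
  have : UniformSmoothSpace (WithLp (ENNReal.ofReal p) (Y × U)) :=
    WithLp.uniformSmoothSpace_prod hp
  set M := {z : WithLp (ENNReal.ofReal p) (Y × U) | z.fst = S z.snd} with hM
  have hcost : ∀ x w : WithLp (ENNReal.ofReal p) (Y × U),
      trackingCost p x.fst x.snd (WithLp.ofLp w) = dist x w ^ p := fun x w => by
    rw [dist_comm, dist_eq_norm, WithLp.prod_norm_rpow hp0]
    rfl
  have hsol : ∀ x, ∀ a ∈ M, dist x a = Metric.infDist x M →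
      WithLp.ofLp a ∈ trackingSolutions p S x.fst x.snd := fun x a ha hxa => by
    refine ⟨ha, fun w hw => ?_⟩
    have hwM : WithLp.toLp (ENNReal.ofReal p) w ∈ M := hw
    rw [Set.mem_ofPred_eq, hcost, ← WithLp.ofLp_toLp (ENNReal.ofReal p) w, hcost, hxa]
    exact Real.rpow_le_rpow Metric.infDist_nonneg (Metric.infDist_le_dist_of_mem hwM) hp0.le
  have huniq : ∀ x, ∀ a ∈ M, ∀ b ∈ M, dist x a = Metric.infDist x M →
      dist x b = Metric.infDist x M → a = b := fun x a ha b hb hxa hxb =>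
    WithLp.ofLp_injective _ (hsub x.fst x.snd (hsol x a ha hxa) (hsol x b hb hxb))
  refine hS (exists_affineMap_eq_of_map_midpoint (fun u v => ?_) hSw)
  have hmid : midpoint ℝ (WithLp.toLp (ENNReal.ofReal p) (S u, u)) (WithLp.toLp _ (S v, v)) ∈ M :=
    (approximativelyCompact_graph hp hSw).midpoint_mem huniq rfl rfl
  rw [midpoint_eq_smul_add] at hmid
  rw [midpoint_eq_smul_add, midpoint_eq_smul_add]
  exact hmid.symm
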